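/- A \emph{Heyting-Lewis algebra} is a Heyting algebra $A$ with a binary operation $\Rightarrow$ (strict implication, distinct from the Heyting implication $\to$) satisfying, for all $a,b,c\in A$: $(a\Rightarrow b)\wedge(a\Rightarrow c)=a\Rightarrow(b\wedge c)$; $(a\Rightarrow c)\wedge(b\Rightarrow c)=(a\vee b)\Rightarrow c$; $(a\Rightarrow b)\wedge(b\Rightarrow c)\le a\Rightarrow c$; $a\Rightarrow a=\top$. The category $\mathsf{HLAs}$ has these as objects and the Heyting homomorphisms preserving $\Rightarrow$ as morphisms. A \emph{general strict-implication frame} is a tuple $(X,\preceq,\sqsubset,P)$ where $(X,\preceq)$ is a poset (possibly empty), $\sqsubset$ is a binary relation on $X$ such that $x\preceq y\sqsubset z$ implies $x\sqsubset z$, and $P$ is a collection of $\preceq$-upsets containing $X$ and $\emptyset$ and closed under $\cap$, $\cup$ and the operations $$a\mathbin{\underline{\to}} b=\{x : \forall y\,(x\preceq y,\ y\in a \text{ imply } y\in b)\},\qquad a\mathbin{\underline{\Rightarrow}} b=\{x : \forall y\,(x\sqsubset y,\ y\in a\text{ imply } y\in b)\}.$$ It is \emph{descriptive} if moreover: (compactness)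 for all $\mathcal A\subseteq P$ and $\mathcal B\subseteq\{X\setminus a : a\in P\}$, if every finite subfamily of $\mathcal A\cup\mathcal B$ has non-empty intersection (the empty subfamily having intersection $X$), then $\bigcap(\mathcal A\cup\mathcal B)\neq\emptyset$; ($\preceq$-refinedness) if $x\not\preceq y$ then there is $a\in P$ with $x\in a$ and $y\notin a$; ($\sqsubset$-refinedness) if $x\not\sqsubset y$ then there are $a,b\in P$ with $x\in a\mathbin{\underline{\Rightarrow}}b$, $y\in a$ and $y\notin b$. The category $\mathsf{D\text{-}Frm}$ has the descriptive frames as objects; a morphism from $(X,\preceq,\sqsubset,P)$ to $(X',\preceq',\sqsubset',P')$ is a function $f:X\to X'$ such that for each pair $(R,R')\in\{(\preceq,\preceq'),(\sqsubset,\sqsubset')\}$, $xRy$ implies $f(x)R'f(y)$, and $f(x)R'z'$ implies that there is $z$ with $xRz$ and $f(z)=z'$, and such that $f^{-1}(a')\in P$ for all $a'\in P'$. For a descriptive frame $\mathfrak G=(X,\preceq,\sqsubset,P)$ let $\mathfrak G^*$ be $P$, ordered by inclusion, with Heyting implication $\underline{\to}$ and strict implication $\underline{\Rightarrow}$, and for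 a morphism $f$ let $f^*=f^{-1}$; this is a contravariant functor $(\cdot)^*:\mathsf{D\text{-}Frm}\to\mathsf{HLAs}$. For a Heyting-Lewis algebra $A$ let $A_*=(\mathrm{pf}A,\subseteq,\sqsubset,\tilde A)$, where $\mathrm{pf}A$ is the set of prime filters of $A$, $\mathfrak p\sqsubset\mathfrak q$ iff for all $a,b\in A$, $a\Rightarrow b\in\mathfrak p$ and $a\in\mathfrak q$ imply $b\in\mathfrak q$, and $\tilde A=\{\tilde a : a\in A\}$ with $\tilde a=\{\mathfrak p\in\mathrm{pf}A : a\in\mathfrak p\}$; for a morphism $h$ let $h_*=h^{-1}$. \textbf{Theorem.} For every Heyting-Lewis algebra $A$ and all $a,b\in A$, $\widetilde{a\Rightarrow b}=\tilde a\mathbin{\underline{\Rightarrow}}\tilde b$. Moreover, $A_*$ is a descriptive frame for every $A$, $h_*$ is a morphism of descriptive frames for every morphism $h$ of Heyting-Lewis algebras, so that $(\cdot)_*:\mathsf{HLAs}\to\mathsf{D\text{-}Frm}$ is a contravariant functor, and the functors $(\cdot)_*$ and $(\cdot)^*$ form a dual equivalence $\mathsf{HLAs}\equiv^{op}\mathsf{D\text{-}Frm}$.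 -/

import Mathlib

open CategoryTheory Opposite

universe u

/-! ### Heyting-Lewis algebras -/

/-- A Heyting-Lewis algebra: a Heyting algebra with a binary operator `⥽` (strict implication)
that makes its lattice reduct a weak Heyting algebra. -/
class HeytingLewisAlgebra (A : Type u) extends HeytingAlgebra A where
  /-- Strict implication. -/
  sto : A → A → A
  sto_inf_sto : ∀ a b c : A, sto a b ⊓ sto a c = sto a (b ⊓ c)
  sto_sup : ∀ a b c : A, sto a c ⊓ sto b c = sto (a ⊔ b) c
  sto_trans : ∀ a b c : A, sto a b ⊓ sto b c ≤ sto a c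
  sto_self : ∀ a : A, sto a a = ⊤

infixr:60 " ⥽ " => HeytingLewisAlgebra.sto

/-- The objects of the category of Heyting-Lewis algebras. -/
structure HLAlg : Type (u + 1) where
  carrier : Type u
  [str : HeytingLewisAlgebra carrier]

namespace HLAlg

instance : CoeSort HLAlg.{u} (Type u) := ⟨HLAlg.carrier⟩

attribute [instance] HLAlg.str

/-- Morphisms of Heyting-Lewis algebras: Heyting homomorphisms that preserve `⥽`. -/
@[ext]
structure Hom (A B : HLAlg.{u}) where
  toHeytingHom : HeytingHom A B
  map_sto : ∀ a b : A, toHeytingHom (a ⥽ b) = toHeytingHom a ⥽ toHeytingHom b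

instance : Category HLAlg.{u} where
  Hom A B := Hom A B
  id A := ⟨HeytingHom.id A, fun _ _ => rfl⟩
  comp f g := ⟨g.toHeytingHom.comp f.toHeytingHom, fun a b => by
    simp [f.map_sto, g.map_sto]⟩

end HLAlg

/-! ### General and descriptive strict-implication frames -/

/-- The raw data `(X, ≼, ⊏, P)` of a general frame: a poset, a binary relation on it and a
collection of subsets (the admissible ones). The axioms are in `IsGeneral` and `IsDescriptive`. -/
structure FrameData : Type (u + 1) where
  carrier : Type u
  [order : PartialOrder carrier]
  rel : carrier → carrier → Prop
  admissible : Set (Set carrier)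

namespace FrameData

instance : CoeSort FrameData.{u} (Type u) := ⟨FrameData.carrier⟩

attribute [instance] FrameData.order

/-- The Heyting implication of sets of states, computed along `≼`. -/
def impSet (F : FrameData.{u}) (a b : Set F) : Set F :=
  {x | ∀ y, x ≤ y → y ∈ a → y ∈ b}

/-- The strict implication of sets of states, computed along `⊏`. -/
def stoSet (F : FrameData.{u}) (a b : Set F) : Set F :=
  {x | ∀ y, F.rel x y → y ∈ a → y ∈ b}

/-- General strict-implication frames. -/
structure IsGeneral (F : FrameData.{u}) : Prop where
  rel_of_le_of_rel : ∀ x y z : F, x ≤ y → F.rel y z → F.rel x z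
  isUpperSet : ∀ a ∈ F.admissible, IsUpperSet a
  univ_mem : Set.univ ∈ F.admissible
  empty_mem : ∅ ∈ F.admissible
  inter_mem : ∀ a ∈ F.admissible, ∀ b ∈ F.admissible, a ∩ b ∈ F.admissible
  union_mem : ∀ a ∈ F.admissible, ∀ b ∈ F.admissible, a ∪ b ∈ F.admissible
  impSet_mem : ∀ a ∈ F.admissible, ∀ b ∈ F.admissible, F.impSet a b ∈ F.admissible
  stoSet_mem : ∀ a ∈ F.admissible, ∀ b ∈ F.admissible, F.stoSet a b ∈ F.admissible

/-- Descriptive strict-implication frames. In `compact`, the finite intersection property includes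
the empty subfamily, whose intersection is the whole set of states; this matters only for the
empty frame, which is the dual of the one-element algebra. -/
structure IsDescriptive (F : FrameData.{u}) : Prop extends IsGeneral F where
  compact : ∀ 𝒜 ⊆ F.admissible, ∀ ℬ ⊆ {c : Set F | ∃ a ∈ F.admissible, c = aᶜ},
    (∀ 𝒮 ⊆ 𝒜 ∪ ℬ, 𝒮.Finite → (⋂₀ 𝒮).Nonempty) → (⋂₀ (𝒜 ∪ ℬ)).Nonempty
  le_refined : ∀ x y : F, ¬ x ≤ y → ∃ a ∈ F.admissible, x ∈ a ∧ y ∉ a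
  rel_refined : ∀ x y : F, ¬ F.rel x y →
    ∃ a ∈ F.admissible, ∃ b ∈ F.admissible, x ∈ F.stoSet a b ∧ y ∈ a ∧ y ∉ b

/-- Morphisms of general frames: functions that are bounded for both relations and for which
preimages of admissible sets are admissible. -/
structure IsMorphism (F G : FrameData.{u}) (f : F → G) : Prop where
  map_le : ∀ x y : F, x ≤ y → f x ≤ f y
  exists_le : ∀ (x : F) (z' : G), f x ≤ z' → ∃ z : F, x ≤ z ∧ f z = z'
  map_rel : ∀ x y : F, F.rel x y → G.rel (f x) (f y)
  exists_rel : ∀ (x : F) (z' : G), G.rel (f x) z' → ∃ z : F, F.rel x z ∧ f z = z'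
  preimage_mem : ∀ a ∈ G.admissible, f ⁻¹' a ∈ F.admissible

theorem IsMorphism.id (F : FrameData.{u}) : IsMorphism F F _root_.id where
  map_le _ _ h := h
  exists_le _ z h := ⟨z, h, rfl⟩
  map_rel _ _ h := h
  exists_rel _ z h := ⟨z, h, rfl⟩
  preimage_mem _ h := h

theorem IsMorphism.comp {F G H : FrameData.{u}} {g : G → H} {f : F → G}
    (hg : IsMorphism G H g) (hf : IsMorphism F G f) : IsMorphism F H (g ∘ f) where
  map_le _ _ h := hg.map_le _ _ (hf.map_le _ _ h)
  exists_le x z h := by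
    obtain ⟨y, hy, rfl⟩ := hg.exists_le _ z h
    obtain ⟨w, hw, rfl⟩ := hf.exists_le _ y hy
    exact ⟨w, hw, rfl⟩
  map_rel _ _ h := hg.map_rel _ _ (hf.map_rel _ _ h)
  exists_rel x z h := by
    obtain ⟨y, hy, rfl⟩ := hg.exists_rel _ z h
    obtain ⟨w, hw, rfl⟩ := hf.exists_rel _ y hy
    exact ⟨w, hw, rfl⟩
  preimage_mem _ h := hf.preimage_mem _ (hg.preimage_mem _ h)

/-- The admissible sets of a general frame, ordered by inclusion, form a Heyting-Lewis algebra
under union, intersection and the two set-theoretic implications. -/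
abbrev algebra (F : FrameData.{u}) (hF : F.IsGeneral) : HeytingLewisAlgebra F.admissible where
  le a b := (a : Set F) ⊆ b
  le_refl _ := subset_rfl
  le_trans _ _ _ h h' := h.trans h'
  le_antisymm _ _ h h' := Subtype.ext (h.antisymm h')
  sup a b := ⟨a ∪ b, hF.union_mem _ a.2 _ b.2⟩
  le_sup_left _ _ := Set.subset_union_left
  le_sup_right _ _ := Set.subset_union_right
  sup_le _ _ _ h h' := Set.union_subset h h'
  inf a b := ⟨a ∩ b, hF.inter_mem _ a.2 _ b.2⟩
  inf_le_left _ _ := Set.inter_subset_left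
  inf_le_right _ _ := Set.inter_subset_right
  le_inf _ _ _ h h' := Set.subset_inter h h'
  top := ⟨Set.univ, hF.univ_mem⟩
  le_top _ := Set.subset_univ _
  bot := ⟨∅, hF.empty_mem⟩
  bot_le _ := Set.empty_subset _
  himp a b := ⟨F.impSet a b, hF.impSet_mem _ a.2 _ b.2⟩
  le_himp_iff a b c := by
    constructor
    · rintro h x ⟨hxa, hxb⟩
      exact h hxa x le_rfl hxb
    · intro h x hx y hxy hy
      exact h ⟨hF.isUpperSet _ a.2 hxy hx, hy⟩
  compl a := ⟨F.impSet a ∅, hF.impSet_mem _ a.2 _ hF.empty_mem⟩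
  himp_bot _ := rfl
  sto a b := ⟨F.stoSet a b, hF.stoSet_mem _ a.2 _ b.2⟩
  sto_inf_sto a b c := Subtype.ext <| Set.ext fun _ =>
    ⟨fun h y hy hya => ⟨h.1 y hy hya, h.2 y hy hya⟩,
      fun h => ⟨fun y hy hya => (h y hy hya).1, fun y hy hya => (h y hy hya).2⟩⟩
  sto_sup a b c := Subtype.ext <| Set.ext fun _ =>
    ⟨fun h y hy hyab => hyab.elim (h.1 y hy) (h.2 y hy),
      fun h => ⟨fun y hy hya => h y hy (Or.inl hya), fun y hy hyb => h y hy (Or.inr hyb)⟩⟩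
  sto_trans a b c := fun _ h y hy hya => h.2 y hy (h.1 y hy hya)
  sto_self a := Subtype.ext <| Set.eq_univ_of_forall fun _ _ _ h => h

end FrameData

/-- The objects of the category of descriptive strict-implication frames. -/
structure DFrm : Type (u + 1) where
  data : FrameData.{u}
  isDescriptive : data.IsDescriptive

namespace DFrm

/-- Morphisms of descriptive frames: all morphisms of general frames between them. -/
@[ext]
structure Hom (F G : DFrm.{u}) where
  toFun : F.data → G.data
  isMorphism : FrameData.IsMorphism F.data G.data toFun

instance : Category DFrm.{u} where
  Hom F G := Hom F G
  id F := ⟨id, .id F.data⟩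
  comp f g := ⟨g.toFun ∘ f.toFun, g.isMorphism.comp f.isMorphism⟩

end DFrm

/-! ### From frames to algebras -/

/-- The Heyting-Lewis algebra of admissible sets of a descriptive frame. -/
def DFrm.upperStarObj (F : DFrm.{u}) : HLAlg.{u} where
  carrier := F.data.admissible
  str := F.data.algebra F.isDescriptive.toIsGeneral

/-- A frame morphism acts on admissible sets by preimage. -/
def DFrm.upperStarMap {F G : DFrm.{u}} (f : F ⟶ G) : G.upperStarObj ⟶ F.upperStarObj where
  toHeytingHom :=
    { toFun := fun (a : G.data.admissible) => ⟨f.toFun ⁻¹' a.1, f.isMorphism.preimage_mem _ a.2⟩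
      map_sup' := fun _ _ => rfl
      map_inf' := fun _ _ => rfl
      map_bot' := rfl
      map_himp' := fun (a b : G.data.admissible) => Subtype.ext <| Set.ext fun x => by
        constructor
        · intro h y hxy hy
          exact h _ (f.isMorphism.map_le _ _ hxy) hy
        · intro h z' hz' hza
          obtain ⟨z, hz, rfl⟩ := f.isMorphism.exists_le _ _ hz'
          exact h z hz hza }
  map_sto a b := Subtype.ext <| Set.ext fun x => by
    constructor
    · intro h y hxy hy
      exact h _ (f.isMorphism.map_rel _ _ hxy) hy
    · intro h z' hz' hza
      obtain ⟨z, hz, rfl⟩ := f.isMorphism.exists_rel _ _ hz'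
      exact h z hz hza

/-- The contravariant functor `(·)^*` from descriptive frames to Heyting-Lewis algebras. -/
def upperStar : DFrm.{u}ᵒᵖ ⥤ HLAlg.{u} where
  obj F := F.unop.upperStarObj
  map f := DFrm.upperStarMap f.unop
  map_id _ := rfl
  map_comp _ _ := rfl

/-! ### From algebras to frames -/

namespace HLAlg

/-- The prime filters of a Heyting-Lewis algebra, ordered by inclusion. -/
abbrev PrimeFilter (A : HLAlg.{u}) : Type u := {p : Order.PFilter A // p.IsPrime}

/-- The set of prime filters that contain `a`. -/
def tilde (A : HLAlg.{u}) (a : A) : Set A.PrimeFilter := {p | a ∈ p.1}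

/-- The data `(pf A, ⊆, ⊏, Ã)` dual to a Heyting-Lewis algebra. -/
abbrev lowerStarData (A : HLAlg.{u}) : FrameData.{u} where
  carrier := A.PrimeFilter
  rel p q := ∀ a b : A, a ⥽ b ∈ p.1 → a ∈ q.1 → b ∈ q.1
  admissible := Set.range A.tilde

/-- The preimage of a prime filter under a morphism of Heyting-Lewis algebras. -/
def comapPrimeFilter {A B : HLAlg.{u}} (h : A ⟶ B) (p : B.PrimeFilter) : A.PrimeFilter :=
  ⟨Order.IsPFilter.toPFilter (F := {a : A | h.toHeytingHom a ∈ p.1}) <| .of_def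
      ⟨⊤, by simp⟩
      (fun x hx y hy => ⟨x ⊓ y, by
        simpa using Order.PFilter.inf_mem hx hy, inf_le_left, inf_le_right⟩)
      (fun hxy hx => Order.PFilter.mem_of_le (OrderHomClass.mono h.toHeytingHom hxy) hx), by
    refine ⟨fun x y hyx (hx : h.toHeytingHom x ∉ p.1) (hy : h.toHeytingHom y ∈ p.1) =>
      hx (Order.PFilter.mem_of_le (OrderHomClass.mono h.toHeytingHom hyx) hy), ⟨⊥, ?_⟩, ?_⟩
    · intro (hb : h.toHeytingHom ⊥ ∈ p.1)
      rw [map_bot] at hb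
      obtain ⟨x, hx⟩ := p.2.compl_ideal.Nonempty
      exact hx (Order.PFilter.mem_of_le bot_le hb)
    · intro x hx y hy
      refine ⟨x ⊔ y, ?_, le_sup_left, le_sup_right⟩
      intro (hxy : h.toHeytingHom (x ⊔ y) ∈ p.1)
      obtain ⟨z, hz, hxz, hyz⟩ := p.2.compl_ideal.Directed _ hx _ hy
      rw [map_sup] at hxy
      exact hz (Order.PFilter.mem_of_le (sup_le hxz hyz) hxy)⟩

theorem mem_comapPrimeFilter {A B : HLAlg.{u}} (h : A ⟶ B) (p : B.PrimeFilter) (a : A) :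
    a ∈ (comapPrimeFilter h p).1 ↔ h.toHeytingHom a ∈ p.1 := Iff.rfl

end HLAlg

/-- The contravariant functor `(·)_*` from Heyting-Lewis algebras to descriptive frames. Its two
arguments say that it is well defined on objects and on morphisms. -/
def lowerStar
    (hobj : ∀ A : HLAlg.{u}, A.lowerStarData.IsDescriptive)
    (hmap : ∀ (A B : HLAlg.{u}) (h : A ⟶ B),
      FrameData.IsMorphism B.lowerStarData A.lowerStarData (HLAlg.comapPrimeFilter h)) :
    HLAlg.{u} ⥤ DFrm.{u}ᵒᵖ where
  obj A := op ⟨A.lowerStarData, hobj A⟩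
  map {A B} h := Quiver.Hom.op
    (⟨HLAlg.comapPrimeFilter h, hmap A B h⟩ :
      DFrm.Hom ⟨B.lowerStarData, hobj B⟩ ⟨A.lowerStarData, hobj A⟩)
  map_id _ := rfl
  map_comp _ _ := rfl

/-!
The heart of the proof is a relative prime filter theorem. For a filter `p` of a Heyting-Lewis
algebra, `a ⥽ b ∈ p` is an entailment relation between `a` and `b`, and the `⊏`-successors of `p`
are the prime filters closed under it. These correspond to the prime filters of the quotient of the
lattice by mutual entailment, so the usual prime filter theorem applied to this quotient provides
enough of them. The entailment `a ⇨ b ∈ p` is treated in the same way: the prime filters closed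
under it are those above `p`.

Compactness of the dual frame comes from ultrafilters: `{a | ã ∈ 𝒰}` is a prime filter for every
ultrafilter `𝒰` on the set of prime filters, because `a ↦ ã` is a lattice homomorphism. Conversely,
compactness of a descriptive frame yields, for each prime filter of admissible sets, a state that
lies in exactly its members.
-/

/-! ### Prime filters and entailment relations -/

section PrimeFilters

variable {A : Type*}

theorem sup_mem_iff_of_isPrime [SemilatticeSup A] {p : Order.PFilter A} (hp : p.IsPrime) {a b : A} :
    a ⊔ b ∈ p ↔ a ∈ p ∨ b ∈ p := by
  have h : a ⊔ b ∉ p ↔ a ∉ p ∧ b ∉ p := Order.Ideal.sup_mem_iff (I := hp.compl_ideal.toIdeal)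
  rw [← not_iff_not, h, not_or]

/-- The prime filter with underlying set `s`, for a set `s` whose indicator function is a
nonconstant lattice homomorphism. -/
def primeFilterOfSet [Lattice A] (s : Set A) (hne : s.Nonempty) (hne' : sᶜ.Nonempty)
    (hinf : ∀ a b, a ⊓ b ∈ s ↔ a ∈ s ∧ b ∈ s) (hsup : ∀ a b, a ⊔ b ∈ s ↔ a ∈ s ∨ b ∈ s) :
    {p : Order.PFilter A // p.IsPrime} :=
  have hupper {a b : A} (hab : a ≤ b) (ha : a ∈ s) : b ∈ s :=
    sup_eq_right.mpr hab ▸ (hsup a b).mpr (Or.inl ha)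
  have hfilter : Order.IsPFilter s := .of_def hne
    (fun a ha b hb => ⟨a ⊓ b, (hinf a b).mpr ⟨ha, hb⟩, inf_le_left, inf_le_right⟩) hupper
  have hideal : Order.IsIdeal sᶜ :=
    ⟨fun _ _ hba => mt (hupper hba), hne',
      fun a ha b hb => ⟨a ⊔ b, fun h => ((hsup a b).mp h).elim ha hb, le_sup_left, le_sup_right⟩⟩
  ⟨hfilter.toPFilter, ⟨hideal⟩⟩

theorem exists_isPrime_of_forall_not_le [DistribLattice A] {S T : Set A}
    (hS : S.Nonempty) (hSinf : InfClosed S) (hT : T.Nonempty) (hTsup : SupClosed T)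
    (hST : ∀ s ∈ S, ∀ t ∈ T, ¬ s ≤ t) :
    ∃ q : Order.PFilter A, q.IsPrime ∧ (∀ s ∈ S, s ∈ q) ∧ ∀ t ∈ T, t ∉ q := by
  have hF : Order.IsPFilter (upperClosure S : Set A) := by
    refine .of_def (hS.mono subset_upperClosure) ?_ fun h => (upperClosure S).upper h
    rintro a ⟨s, hs, hsa⟩ b ⟨s', hs', hsb⟩
    exact ⟨s ⊓ s', subset_upperClosure (hSinf hs hs'), inf_le_of_left_le hsa,
      inf_le_of_right_le hsb⟩
  have hI : Order.IsIdeal (lowerClosure T : Set A) := by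
    refine ⟨(lowerClosure T).lower, hT.mono subset_lowerClosure, ?_⟩
    rintro a ⟨t, ht, hat⟩ b ⟨t', ht', hbt⟩
    exact ⟨t ⊔ t', subset_lowerClosure (hTsup ht ht'), le_sup_of_le_left hat,
      le_sup_of_le_right hbt⟩
  have hFI : Disjoint (hF.toPFilter : Set A) (hI.toIdeal : Set A) := by
    refine Set.disjoint_left.mpr ?_
    rintro a ⟨s, hs, hsa⟩ ⟨t, ht, hat⟩
    exact hST s hs t ht (hsa.trans hat)
  obtain ⟨J, hJ, hIJ, hFJ⟩ := DistribLattice.prime_ideal_of_disjoint_filter_ideal hFI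
  exact ⟨hJ.toPrimePair.F, hJ.toPrimePair.F_isPrime,
    fun s hs => Set.disjoint_left.mp hFJ (subset_upperClosure hs),
    fun t ht h => h (hIJ (subset_lowerClosure ht))⟩

/-- Entailment relations on a lattice: preorders that extend the lattice order and for which `⊓` and
`⊔` are still a meet and a join. The relations `a ⥽ b ∈ p` and `a ⇨ b ∈ p` given by a filter `p` are
the examples of interest. -/
structure IsEntailment [Lattice A] (R : A → A → Prop) : Prop where
  of_le : ∀ {a b}, a ≤ b → R a b
  trans : ∀ {a b c}, R a b → R b c → R a c
  le_inf : ∀ {a b c}, R a b → R a c → R a (b ⊓ c)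
  sup_le : ∀ {a b c}, R a c → R b c → R (a ⊔ b) c

theorem isEntailment_le [Lattice A] : IsEntailment (A := A) (· ≤ ·) where
  of_le := id
  trans := le_trans
  le_inf := le_inf
  sup_le := sup_le

namespace IsEntailment

section Lattice

variable [Lattice A] {R : A → A → Prop} (hR : IsEntailment R)
include hR

theorem inf_mono {a b c d : A} (hac : R a c) (hbd : R b d) : R (a ⊓ b) (c ⊓ d) :=
  hR.le_inf (hR.trans (hR.of_le inf_le_left) hac) (hR.trans (hR.of_le inf_le_right) hbd)

theorem sup_mono {a b c d : A} (hac : R a c) (hbd : R b d) : R (a ⊔ b) (c ⊔ d) :=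
  hR.sup_le (hR.trans hac (hR.of_le le_sup_left)) (hR.trans hbd (hR.of_le le_sup_right))

/-- Mutual entailment, as an equivalence relation. -/
def setoid : Setoid A where
  r a b := R a b ∧ R b a
  iseqv :=
    { refl := fun _ => ⟨hR.of_le le_rfl, hR.of_le le_rfl⟩
      symm := And.symm
      trans := fun h h' => ⟨hR.trans h.1 h'.1, hR.trans h'.2 h.2⟩ }

/-- The quotient of a lattice by mutual entailment. It is a separate type because quotients of
preorders already carry an order in Mathlib, which differs from the one by entailment. -/
def Lindenbaum : Type _ := Quotient hR.setoid

instance : Lattice hR.Lindenbaum where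
  le := Quotient.lift₂ R fun _ _ _ _ h h' =>
    propext ⟨fun hab => hR.trans h.2 (hR.trans hab h'.1),
      fun hab => hR.trans h.1 (hR.trans hab h'.2)⟩
  le_refl := Quotient.ind fun _ => hR.of_le le_rfl
  le_trans := by rintro ⟨a⟩ ⟨b⟩ ⟨c⟩; exact hR.trans
  le_antisymm := by rintro ⟨a⟩ ⟨b⟩ hab hba; exact Quotient.sound ⟨hab, hba⟩
  inf := Quotient.map₂ (· ⊓ ·) fun _ _ h _ _ h' => ⟨hR.inf_mono h.1 h'.1, hR.inf_mono h.2 h'.2⟩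
  inf_le_left := by rintro ⟨a⟩ ⟨b⟩; exact hR.of_le inf_le_left
  inf_le_right := by rintro ⟨a⟩ ⟨b⟩; exact hR.of_le inf_le_right
  le_inf := by rintro ⟨a⟩ ⟨b⟩ ⟨c⟩; exact hR.le_inf
  sup := Quotient.map₂ (· ⊔ ·) fun _ _ h _ _ h' => ⟨hR.sup_mono h.1 h'.1, hR.sup_mono h.2 h'.2⟩
  le_sup_left := by rintro ⟨a⟩ ⟨b⟩; exact hR.of_le le_sup_left
  le_sup_right := by rintro ⟨a⟩ ⟨b⟩; exact hR.of_le le_sup_right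
  sup_le := by rintro ⟨a⟩ ⟨b⟩ ⟨c⟩; exact hR.sup_le

/-- The projection of a lattice onto its quotient by mutual entailment. -/
def toLindenbaum : LatticeHom A hR.Lindenbaum where
  toFun := Quotient.mk _
  map_sup' _ _ := rfl
  map_inf' _ _ := rfl

theorem toLindenbaum_le_iff {a b : A} : hR.toLindenbaum a ≤ hR.toLindenbaum b ↔ R a b := Iff.rfl

end Lattice

variable [DistribLattice A] {R : A → A → Prop} (hR : IsEntailment R)
include hR

instance : DistribLattice hR.Lindenbaum where
  le_sup_inf := by rintro ⟨a⟩ ⟨b⟩ ⟨c⟩; exact hR.of_le le_sup_inf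

theorem exists_isPrime_of_forall_not {S T : Set A}
    (hS : S.Nonempty) (hSinf : InfClosed S) (hT : T.Nonempty) (hTsup : SupClosed T)
    (hST : ∀ s ∈ S, ∀ t ∈ T, ¬ R s t) :
    ∃ q : Order.PFilter A, q.IsPrime ∧ (∀ a b, R a b → a ∈ q → b ∈ q) ∧
      (∀ s ∈ S, s ∈ q) ∧ ∀ t ∈ T, t ∉ q := by
  obtain ⟨q, hq, hSq, hTq⟩ := exists_isPrime_of_forall_not_le (hS.image hR.toLindenbaum)
    (hSinf.image hR.toLindenbaum) (hT.image hR.toLindenbaum) (hTsup.image hR.toLindenbaum)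
    (by rintro _ ⟨s, hs, rfl⟩ _ ⟨t, ht, rfl⟩; exact mt hR.toLindenbaum_le_iff.mp (hST s hs t ht))
  rw [Set.forall_mem_image] at hSq hTq
  have hqR a b (hab : R a b) : hR.toLindenbaum a ∈ q → hR.toLindenbaum b ∈ q :=
    Order.PFilter.mem_of_le (hR.toLindenbaum_le_iff.mpr hab)
  let r := primeFilterOfSet {a | hR.toLindenbaum a ∈ q} (hS.mono fun _ hs => hSq hs)
    (hT.mono fun _ ht => hTq ht)
    (fun a b => by simp only [Set.mem_ofPred_eq, map_inf, Order.PFilter.inf_mem_iff])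
    (fun a b => by simp only [Set.mem_ofPred_eq, map_sup, sup_mem_iff_of_isPrime hq])
  exact ⟨r.1, r.2, hqR, fun _ hs => hSq hs, fun _ ht => hTq ht⟩

theorem iff_forall_isPrime {a b : A} :
    R a b ↔ ∀ q : Order.PFilter A, q.IsPrime → (∀ x y, R x y → x ∈ q → y ∈ q) → a ∈ q → b ∈ q := by
  refine ⟨fun hab q _ hqR => hqR a b hab, fun h => ?_⟩
  by_contra hab
  obtain ⟨q, hq, hqR, ha, hb⟩ := hR.exists_isPrime_of_forall_not (Set.singleton_nonempty a)
    infClosed_singleton (Set.singleton_nonempty b) supClosed_singleton (by simpa using hab)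
  exact hb b rfl (h q hq hqR (ha a rfl))

theorem exists_isPrime_forall_map_mem_iff {B F : Type*} [Lattice B] [FunLike F B A]
    [LatticeHomClass F B A] (h : F) {q : Order.PFilter B} (hq : q.IsPrime)
    (hqR : ∀ a b, R (h a) (h b) → a ∈ q → b ∈ q) :
    ∃ r : Order.PFilter A, r.IsPrime ∧ (∀ x y, R x y → x ∈ r → y ∈ r) ∧ ∀ a, h a ∈ r ↔ a ∈ q := by
  have hinf : InfClosed {a | a ∈ q} := fun _ ha _ hb => Order.PFilter.inf_mem ha hb
  have hsup : SupClosed {a | a ∉ q} := fun _ ha _ hb hab =>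
    (sup_mem_iff_of_isPrime hq |>.mp hab).elim ha hb
  obtain ⟨r, hr, hrR, hmem, hnot⟩ := hR.exists_isPrime_of_forall_not (q.nonempty.image h)
    (hinf.image h) (hq.compl_ideal.Nonempty.image h) (hsup.image h)
    (by rintro _ ⟨a, ha, rfl⟩ _ ⟨b, hb, rfl⟩ hab; exact hb (hqR a b hab ha))
  rw [Set.forall_mem_image] at hmem hnot
  exact ⟨r, hr, hrR, fun a => ⟨not_imp_not.mp fun ha => hnot ha, fun ha => hmem ha⟩⟩

end IsEntailment

theorem isEntailment_himp [GeneralizedHeytingAlgebra A] (p : Order.PFilter A) :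
    IsEntailment fun a b => a ⇨ b ∈ p where
  of_le h := himp_eq_top_iff.mpr h ▸ Order.PFilter.top_mem
  trans h h' := Order.PFilter.mem_of_le (himp_triangle _ _ _) (Order.PFilter.inf_mem h h')
  le_inf {a b c} h h' := himp_inf_distrib a b c ▸ Order.PFilter.inf_mem h h'
  sup_le {a b c} h h' := sup_himp_distrib a b c ▸ Order.PFilter.inf_mem h h'

theorem pfilter_le_iff_forall_himp [GeneralizedHeytingAlgebra A] {p q : Order.PFilter A} :
    p ≤ q ↔ ∀ a b, a ⇨ b ∈ p → a ∈ q → b ∈ q where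
  mp h _ _ hab ha := Order.PFilter.mem_of_le inf_himp_le (Order.PFilter.inf_mem ha (h hab))
  mpr h b hb := h ⊤ b ((top_himp (a := b)).symm ▸ hb) Order.PFilter.top_mem

end PrimeFilters

namespace HeytingLewisAlgebra

variable {A : Type*} [HeytingLewisAlgebra A]

theorem sto_eq_top_of_le {a b : A} (h : a ≤ b) : a ⥽ b = ⊤ := by
  have h' := sto_inf_sto a a b
  rwa [inf_eq_left.mpr h, sto_self, top_inf_eq] at h'

theorem isEntailment_sto (p : Order.PFilter A) : IsEntailment fun a b => a ⥽ b ∈ p where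
  of_le h := sto_eq_top_of_le h ▸ Order.PFilter.top_mem
  trans h h' := Order.PFilter.mem_of_le (sto_trans _ _ _) (Order.PFilter.inf_mem h h')
  le_inf {a b c} h h' := sto_inf_sto a b c ▸ Order.PFilter.inf_mem h h'
  sup_le {a b c} h h' := sto_sup a b c ▸ Order.PFilter.inf_mem h h'

end HeytingLewisAlgebra

/-! ### The dual frame of an algebra -/

namespace HLAlg

variable (A : HLAlg.{u})

theorem tilde_sto (a b : A) :
    A.tilde (a ⥽ b) = A.lowerStarData.stoSet (A.tilde a) (A.tilde b) :=
  Set.ext fun p => (HeytingLewisAlgebra.isEntailment_sto p.1).iff_forall_isPrime.trans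
    ⟨fun h q => h q.1 q.2, fun h q hq => h ⟨q, hq⟩⟩

theorem tilde_himp (a b : A) :
    A.tilde (a ⇨ b) = A.lowerStarData.impSet (A.tilde a) (A.tilde b) :=
  Set.ext fun p => (isEntailment_himp p.1).iff_forall_isPrime.trans
    ⟨fun h q hpq => h q.1 q.2 (pfilter_le_iff_forall_himp.mp hpq),
      fun h q hq hpq => h ⟨q, hq⟩ (pfilter_le_iff_forall_himp.mpr hpq)⟩

theorem tilde_top : A.tilde ⊤ = Set.univ :=
  Set.eq_univ_of_forall fun _ => Order.PFilter.top_mem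

theorem tilde_bot : A.tilde ⊥ = ∅ :=
  Set.eq_empty_of_forall_notMem fun p => Order.Ideal.bot_mem p.2.compl_ideal.toIdeal

theorem tilde_inf (a b : A) : A.tilde (a ⊓ b) = A.tilde a ∩ A.tilde b :=
  Set.ext fun _ => Order.PFilter.inf_mem_iff

theorem tilde_sup (a b : A) : A.tilde (a ⊔ b) = A.tilde a ∪ A.tilde b :=
  Set.ext fun p => sup_mem_iff_of_isPrime p.2

theorem tilde_subset_tilde_iff {a b : A} : A.tilde a ⊆ A.tilde b ↔ a ≤ b where
  mp h := isEntailment_le.iff_forall_isPrime.mpr fun q hq _ ha =>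
    h (show (⟨q, hq⟩ : A.PrimeFilter) ∈ A.tilde a from ha)
  mpr h _ ha := Order.PFilter.mem_of_le h ha

theorem lowerStarData_isGeneral : A.lowerStarData.IsGeneral where
  rel_of_le_of_rel _ _ _ hxy hyz a b hab := hyz a b (hxy hab)
  isUpperSet := by
    rintro _ ⟨a, rfl⟩ p q hpq hp
    exact hpq hp
  univ_mem := ⟨⊤, A.tilde_top⟩
  empty_mem := ⟨⊥, A.tilde_bot⟩
  inter_mem := by
    rintro _ ⟨a, rfl⟩ _ ⟨b, rfl⟩
    exact ⟨_, A.tilde_inf a b⟩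
  union_mem := by
    rintro _ ⟨a, rfl⟩ _ ⟨b, rfl⟩
    exact ⟨_, A.tilde_sup a b⟩
  impSet_mem := by
    rintro _ ⟨a, rfl⟩ _ ⟨b, rfl⟩
    exact ⟨_, A.tilde_himp a b⟩
  stoSet_mem := by
    rintro _ ⟨a, rfl⟩ _ ⟨b, rfl⟩
    exact ⟨_, A.tilde_sto a b⟩

variable {A} {B : HLAlg.{u}}

/-- The limit of an ultrafilter of prime filters in the patch topology, which is generated by the
sets `ã` and their complements: it consists of the elements `a` for which `ã` is large. -/
def ultrafilterLimit (𝒰 : Ultrafilter A.PrimeFilter) : A.PrimeFilter :=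
  primeFilterOfSet {a | A.tilde a ∈ 𝒰}
    ⟨⊤, show A.tilde ⊤ ∈ 𝒰 from A.tilde_top ▸ Filter.univ_mem⟩
    ⟨⊥, show A.tilde ⊥ ∉ 𝒰 from A.tilde_bot ▸ Ultrafilter.empty_notMem⟩
    (fun a b => show A.tilde (a ⊓ b) ∈ 𝒰 ↔ _ from A.tilde_inf a b ▸ Filter.inter_mem_iff)
    (fun a b => show A.tilde (a ⊔ b) ∈ 𝒰 ↔ _ from A.tilde_sup a b ▸ Ultrafilter.union_mem_iff)

theorem ultrafilterLimit_mem_tilde_iff {𝒰 : Ultrafilter A.PrimeFilter} {a : A} :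
    ultrafilterLimit 𝒰 ∈ A.tilde a ↔ A.tilde a ∈ 𝒰 := Iff.rfl

theorem sInter_nonempty_of_forall_finite {𝒞 : Set (Set A.PrimeFilter)}
    (h𝒞 : 𝒞 ⊆ Set.range A.tilde ∪ {c | ∃ a ∈ Set.range A.tilde, c = aᶜ})
    (hfip : ∀ 𝒮 ⊆ 𝒞, 𝒮.Finite → (⋂₀ 𝒮).Nonempty) : (⋂₀ 𝒞).Nonempty := by
  obtain ⟨𝒰, h𝒰⟩ := Ultrafilter.exists_ultrafilter_of_finite_inter_nonempty 𝒞
    fun 𝒮 h𝒮 => hfip 𝒮 h𝒮 𝒮.finite_toSet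
  refine ⟨ultrafilterLimit 𝒰, fun c hc => ?_⟩
  rcases h𝒞 hc with ⟨a, rfl⟩ | ⟨_, ⟨a, rfl⟩, rfl⟩
  · exact ultrafilterLimit_mem_tilde_iff.mpr (h𝒰 hc)
  · exact mt ultrafilterLimit_mem_tilde_iff.mp (Ultrafilter.compl_mem_iff_notMem.mp (h𝒰 hc))

variable (A) in
theorem lowerStarData_isDescriptive : A.lowerStarData.IsDescriptive where
  toIsGeneral := A.lowerStarData_isGeneral
  compact _ h𝒜 _ hℬ := sInter_nonempty_of_forall_finite (Set.union_subset_union h𝒜 hℬ)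
  le_refined p q hpq := by
    obtain ⟨a, hap, haq⟩ := Set.not_subset.mp hpq
    exact ⟨_, ⟨a, rfl⟩, hap, haq⟩
  rel_refined p q hpq := by
    obtain ⟨a, b, hab, ha, hb⟩ : ∃ a b : A, a ⥽ b ∈ p.1 ∧ a ∈ q.1 ∧ b ∉ q.1 := by
      simpa only [not_forall, exists_prop] using hpq
    exact ⟨_, ⟨a, rfl⟩, _, ⟨b, rfl⟩, A.tilde_sto a b ▸ hab, ha, hb⟩

theorem isMorphism_comapPrimeFilter (h : A ⟶ B) :
    FrameData.IsMorphism B.lowerStarData A.lowerStarData (comapPrimeFilter h) where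
  map_le _ _ hpq _ ha := hpq ha
  exists_le p q hpq := by
    obtain ⟨r, hr, hpr, hrq⟩ := (isEntailment_himp p.1).exists_isPrime_forall_map_mem_iff
      h.toHeytingHom q.2 fun a b hab =>
        pfilter_le_iff_forall_himp.mp hpq a b (by rwa [mem_comapPrimeFilter, map_himp])
    exact ⟨⟨r, hr⟩, pfilter_le_iff_forall_himp.mpr hpr, Subtype.ext (SetLike.ext hrq)⟩
  map_rel p q hpq a b hab ha := hpq _ _ (h.map_sto a b ▸ hab) ha
  exists_rel p q hpq := by
    obtain ⟨r, hr, hpr, hrq⟩ :=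
      (HeytingLewisAlgebra.isEntailment_sto p.1).exists_isPrime_forall_map_mem_iff
        h.toHeytingHom q.2 fun a b hab =>
          hpq a b (by rwa [mem_comapPrimeFilter, h.map_sto])
    exact ⟨⟨r, hr⟩, hpr, Subtype.ext (SetLike.ext hrq)⟩
  preimage_mem := by
    rintro _ ⟨a, rfl⟩
    exact ⟨h.toHeytingHom a, rfl⟩

/-- An order isomorphism that preserves strict implication, as an isomorphism of Heyting-Lewis
algebras. -/
def isoMk (e : A ≃o B) (he : ∀ a b, e (a ⥽ b) = e a ⥽ e b) : A ≅ B where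
  hom := ⟨e, he⟩
  inv := ⟨e.symm, fun a b => e.symm_apply_eq.mpr <| (congrArg₂ _ (e.apply_symm_apply a)
    (e.apply_symm_apply b)).symm.trans (he _ _).symm⟩
  hom_inv_id := Hom.ext (HeytingHom.ext e.symm_apply_apply)
  inv_hom_id := Hom.ext (HeytingHom.ext e.apply_symm_apply)

variable (A)

/-- The descriptive frame dual to a Heyting-Lewis algebra. -/
abbrev lowerStarObj : DFrm.{u} := ⟨A.lowerStarData, A.lowerStarData_isDescriptive⟩

/-- The representation `a ↦ ã` of a Heyting-Lewis algebra by the admissible sets of its dual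
frame. -/
noncomputable def tildeOrderIso : A ≃o A.lowerStarObj.upperStarObj :=
  OrderIso.ofSurjective
    (OrderEmbedding.ofMapLEIff (β := A.lowerStarObj.upperStarObj)
      (Set.rangeFactorization A.tilde) fun _ _ => A.tilde_subset_tilde_iff)
    Set.rangeFactorization_surjective

/-- A Heyting-Lewis algebra is isomorphic to its double dual. -/
noncomputable def tildeIso : A ≅ A.lowerStarObj.upperStarObj :=
  isoMk A.tildeOrderIso fun a b => Subtype.ext (A.tilde_sto a b)

end HLAlg

/-! ### The double dual of a descriptive frame -/

theorem FrameData.isMorphism_of_orderIso {F G : FrameData.{u}} (e : F ≃o G)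
    (hrel : ∀ x y, G.rel (e x) (e y) ↔ F.rel x y)
    (hadm : ∀ b ∈ G.admissible, e ⁻¹' b ∈ F.admissible) : FrameData.IsMorphism F G e where
  map_le _ _ h := e.monotone h
  exists_le _ z h := ⟨e.symm z, e.le_symm_apply.mpr h, e.apply_symm_apply z⟩
  map_rel x y := (hrel x y).mpr
  exists_rel x z h := ⟨e.symm z, (hrel _ _).mp (by rwa [e.apply_symm_apply]), e.apply_symm_apply z⟩
  preimage_mem := hadm

namespace DFrm

/-- An order isomorphism that preserves and reflects `⊏` and the admissible sets, as an isomorphism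
of descriptive frames. -/
def isoMk {F G : DFrm.{u}} (e : F.data ≃o G.data)
    (hrel : ∀ x y, G.data.rel (e x) (e y) ↔ F.data.rel x y)
    (hadm : ∀ b, e ⁻¹' b ∈ F.data.admissible ↔ b ∈ G.data.admissible) : F ≅ G where
  hom := ⟨e, FrameData.isMorphism_of_orderIso e hrel fun b => (hadm b).mpr⟩
  inv := ⟨e.symm, FrameData.isMorphism_of_orderIso e.symm
    (fun x y => by rw [← hrel, e.apply_symm_apply, e.apply_symm_apply])
    fun b hb => (hadm _).mp (by rwa [← e.image_eq_preimage_symm, e.preimage_image])⟩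
  hom_inv_id := Hom.ext (funext e.symm_apply_apply)
  inv_hom_id := Hom.ext (funext e.apply_symm_apply)

variable (F : DFrm.{u})

/-- The prime filter of the admissible sets that contain a state. -/
def pointFilter (x : F.data) : F.upperStarObj.PrimeFilter :=
  primeFilterOfSet (A := F.upperStarObj) {a : F.data.admissible | x ∈ a.1}
    ⟨(⊤ : F.upperStarObj), Set.mem_univ x⟩ ⟨(⊥ : F.upperStarObj), Set.notMem_empty x⟩
    (fun _ _ => Iff.rfl) fun _ _ => Iff.rfl

theorem pointFilter_le_iff {x y : F.data} : F.pointFilter x ≤ F.pointFilter y ↔ x ≤ y := by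
  refine ⟨fun h => ?_, fun h a ha => F.isDescriptive.isUpperSet _ a.2 h ha⟩
  by_contra hxy
  obtain ⟨a, ha, hxa, hya⟩ := F.isDescriptive.le_refined x y hxy
  exact hya (h (show (⟨a, ha⟩ : F.data.admissible) ∈ (F.pointFilter x).1 from hxa))

theorem rel_pointFilter_iff {x y : F.data} :
    F.upperStarObj.lowerStarData.rel (F.pointFilter x) (F.pointFilter y) ↔ F.data.rel x y := by
  refine ⟨fun h => ?_, fun h a b hab ha => hab y h ha⟩
  by_contra hxy
  obtain ⟨a, ha, b, hb, hab, hya, hyb⟩ := F.isDescriptive.rel_refined x y hxy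
  exact hyb (h (⟨a, ha⟩ : F.data.admissible) (⟨b, hb⟩ : F.data.admissible) hab hya)

variable {F}

theorem exists_diff_subset_sInter (p : F.upperStarObj.PrimeFilter) {𝒮 : Set (Set F.data)}
    (hfin : 𝒮.Finite)
    (h𝒮 : ∀ c ∈ 𝒮, (∃ a : F.data.admissible, a ∈ p.1 ∧ c = a.1) ∨
      ∃ b : F.data.admissible, b ∉ p.1 ∧ c = b.1ᶜ) :
    ∃ a b : F.data.admissible, a ∈ p.1 ∧ b ∉ p.1 ∧ a.1 \ b.1 ⊆ ⋂₀ 𝒮 := by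
  induction 𝒮, hfin using Set.Finite.induction_on with
  | empty =>
    obtain ⟨a, ha⟩ := p.1.nonempty
    obtain ⟨b, hb⟩ := p.2.compl_ideal.Nonempty
    exact ⟨a, b, ha, hb, by simp⟩
  | @insert c 𝒮 _ _ ih =>
    obtain ⟨a, b, ha, hb, hab⟩ := ih fun c hc => h𝒮 c (Or.inr hc)
    rw [Set.sInter_insert]
    rcases h𝒮 c (Or.inl rfl) with ⟨a', ha', rfl⟩ | ⟨b', hb', rfl⟩
    · refine ⟨_, b, Order.PFilter.inf_mem (P := F.upperStarObj) ha' ha, hb, ?_⟩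
      exact fun x hx => ⟨hx.1.1, hab ⟨hx.1.2, hx.2⟩⟩
    · refine ⟨a, _, ha, fun h => (sup_mem_iff_of_isPrime p.2 |>.mp h).elim hb' hb, ?_⟩
      exact fun x hx => ⟨fun h => hx.2 (Or.inl h), hab ⟨hx.1, fun h => hx.2 (Or.inr h)⟩⟩

variable (F) in
theorem pointFilter_surjective : Function.Surjective F.pointFilter := by
  intro p
  obtain ⟨x, hx⟩ := F.isDescriptive.compact
    {c | ∃ a : F.data.admissible, a ∈ p.1 ∧ c = a.1}
    (by rintro _ ⟨a, -, rfl⟩; exact a.2)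
    {c | ∃ b : F.data.admissible, b ∉ p.1 ∧ c = b.1ᶜ}
    (by rintro _ ⟨b, -, rfl⟩; exact ⟨_, b.2, rfl⟩)
    (by
      intro 𝒮 h𝒮 hfin
      obtain ⟨a, b, ha, hb, hab⟩ := exists_diff_subset_sInter p hfin h𝒮
      have hnle : ¬ a.1 ⊆ b.1 := fun h => hb (Order.PFilter.mem_of_le h ha)
      exact (Set.sdiff_nonempty.mpr hnle).mono hab)
  refine ⟨x, Subtype.ext (SetLike.ext fun a => ⟨not_imp_not.mp fun ha => ?_, fun ha => ?_⟩)⟩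
  · exact hx _ (Or.inr ⟨a, ha, rfl⟩)
  · exact hx _ (Or.inl ⟨a, ha, rfl⟩)

variable (F)

/-- The representation of the states of a descriptive frame by the prime filters of its algebra. -/
noncomputable def pointOrderIso : F.data ≃o F.upperStarObj.lowerStarData :=
  OrderIso.ofSurjective (OrderEmbedding.ofMapLEIff F.pointFilter fun _ _ => F.pointFilter_le_iff)
    F.pointFilter_surjective

/-- A descriptive frame is isomorphic to its double dual. -/
noncomputable def pointIso : F ≅ F.upperStarObj.lowerStarObj :=
  isoMk F.pointOrderIso (fun _ _ => F.rel_pointFilter_iff) fun b =>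
    ⟨fun hb => ⟨(⟨_, hb⟩ : F.data.admissible), F.pointOrderIso.surjective.preimage_injective rfl⟩,
      by rintro ⟨a, rfl⟩; exact a.2⟩

end DFrm

/-- The dual equivalence between Heyting-Lewis algebras and descriptive frames, with unit `a ↦ ã`
and counit given by the prime filters of the points. -/
noncomputable def starEquivalence : HLAlg.{u} ≌ DFrm.{u}ᵒᵖ :=
  CategoryTheory.Equivalence.mk
    (lowerStar HLAlg.lowerStarData_isDescriptive fun _ _ => HLAlg.isMorphism_comapPrimeFilter)
    upperStar
    (NatIso.ofComponents HLAlg.tildeIso fun _ => rfl)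
    (NatIso.ofComponents (fun F => F.unop.pointIso.op) fun _ => rfl)

theorem mainTheorem1 :
    (∀ (A : HLAlg.{u}) (a b : A),
      A.tilde (a ⥽ b) = A.lowerStarData.stoSet (A.tilde a) (A.tilde b)) ∧
    ∃ (hobj : ∀ A : HLAlg.{u}, A.lowerStarData.IsDescriptive)
      (hmap : ∀ (A B : HLAlg.{u}) (h : A ⟶ B),
        FrameData.IsMorphism B.lowerStarData A.lowerStarData (HLAlg.comapPrimeFilter h))
      (e : HLAlg.{u} ≌ DFrm.{u}ᵒᵖ),
      e.functor = lowerStar hobj hmap ∧ e.inverse = upperStar :=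
  ⟨HLAlg.tilde_sto, HLAlg.lowerStarData_isDescriptive,
    fun _ _ => HLAlg.isMorphism_comapPrimeFilter, starEquivalence, rfl, rfl⟩
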